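/- Let $d\ge 1$ be an integer and $T>0$. Let $\mathcal M(\mathbb R^d)$ be the set of finite Borel measures on $\mathbb R^d$, signed measures being allowed (so that in particular all nonnegative finite Borel measures are included). Let $a:[0,T]\times\mathbb R^d\to[0,\infty)$ be Borel (possibly degenerate and unbounded), let $z^0\in\mathcal M(\mathbb R^d)$, and let $z_1,z_2:[0,T]\to\mathcal M(\mathbb R^d)$ be continuous for the weak topology on finite measures, i.e. $t\mapsto\int f\,dz_i(t)$ is continuous on $[0,T]$ for every bounded continuous $f:\mathbb R^d\to\mathbb R$. Suppose that $z_1$ and $z_2$ both solve $\partial_t z=\Delta(az)$ in the sense of distributions with initial condition $z^0$; that is, for $z\in\{z_1,z_2\}$ and every real Schwartz function $\phi\in\mathcal S(\mathbb R^d)$, the function $a(s,\cdot)\Delta\phi$ is integrable with respect to $|z(s)|$ for almost every $s\in[0,T]$, the function $s\mapsto\int a(s,x)\Delta\phi(x)\,z(s,dx)$ is integrable on $[0,T]$, and for every $t\in[0,T]$ $$\int_{\mathbb R^d}\phi(x)\,z(t,dx)=\int_{\mathbb R^d}\phi(x)\,z^0(dx)+\int_0^t ds\int_{\mathbb R^d}\Delta\phi(x)\,a(s,x)\,z(s,dx).$$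 Assume that there is $\tilde z\in L^1_{\mathrm{loc}}([0,T]\times\mathbb R^d)$ such that, for almost every $t\in[0,T]$, the measure $z_1(t)-z_2(t)$ has density $\tilde z(t,\cdot)$ with respect to Lebesgue measure, and that one of the following holds: (B1) $\displaystyle\int_{[0,T]\times\mathbb R^d}|\tilde z|^2\,dt\,dx<\infty$ and $\displaystyle\int_{[0,T]\times\mathbb R^d}|a\tilde z|^2\,dt\,dx<\infty$; (B2) $d=1$, $\displaystyle\int_{[0,T]\times\mathbb R}|a\tilde z|\,dt\,dx<\infty$, and for every $t_0>0$, $\displaystyle\int_{[t_0,T]\times\mathbb R}|\tilde z|^2\,dt\,dx<\infty$ and $\displaystyle\int_{[t_0,T]\times\mathbb R}|a\tilde z|^2\,dt\,dx<\infty$. Then $z_1(t)-z_2(t)=0$ for every $t\in[0,T]$. -/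

import Mathlib

open MeasureTheory Set Function
open scoped SchwartzMap Laplacian BoundedContinuousFunction

noncomputable section

namespace FokkerPlanck

/-- The state space `ℝ^d` with its Euclidean norm. -/
abbrev E (d : ℕ) : Type := EuclideanSpace ℝ (Fin d)

/-- A time-dependent coefficient `a` is a Borel function on `[0,T] × ℝ^d`
(its values at times outside `[0,T]` are irrelevant). -/
def IsBorelOnStrip {d : ℕ} (T : ℝ) (a : ℝ → E d → ℝ) : Prop :=
  Measurable ((Icc 0 T ×ˢ (univ : Set (E d))).domRestrict (uncurry a))

/-- A function `z` from `[0,T]` to finite (signed) Borel measures on `ℝ^d` is weakly measurable: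
`t ↦ ∫ f dz(t)` is measurable on `[0,T]` for every bounded continuous `f`. -/
def IsWeaklyMeasurable {d : ℕ} (T : ℝ) (z : ℝ → SignedMeasure (E d)) : Prop :=
  ∀ f : E d →ᵇ ℝ, Measurable ((Icc 0 T).domRestrict fun t => ∫ᵛ x, f x ∂<•(z t))

/-- `z` is continuous on `[0,T]` for the weak topology on finite measures, that is, the topology
generated by the maps `μ ↦ ∫ f dμ` with `f` bounded and continuous. -/
def IsWeaklyContinuous {d : ℕ} (T : ℝ) (z : ℝ → SignedMeasure (E d)) : Prop :=
  ∀ f : E d →ᵇ ℝ, ContinuousOn (fun t => ∫ᵛ x, f x ∂<•(z t)) (Icc 0 T)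

/-- `z : [0,T] → M(ℝ^d)` solves `∂ₜ z = Δ(a z)` in the sense of distributions, with initial
condition `z⁰`. The two integrability fields say that the iterated integral on the right-hand side
of the weak formulation makes sense; integrability with respect to a signed measure is
integrability with respect to its total variation. -/
structure IsDistributionalSolution {d : ℕ} (T : ℝ) (a : ℝ → E d → ℝ)
    (z₀ : SignedMeasure (E d)) (z : ℝ → SignedMeasure (E d)) : Prop where
  weaklyMeasurable : IsWeaklyMeasurable T z
  integrable_space : ∀ φ : 𝓢(E d, ℝ), ∀ᵐ s ∂(volume.restrict (Icc 0 T)),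
    (z s).Integrable (fun x => (Δ (φ : E d → ℝ)) x * a s x)
  integrable_time : ∀ φ : 𝓢(E d, ℝ),
    IntegrableOn (fun s => ∫ᵛ x, (Δ (φ : E d → ℝ)) x * a s x ∂<•(z s)) (Icc 0 T)
  weak_eq : ∀ φ : 𝓢(E d, ℝ), ∀ t ∈ Icc 0 T,
    ∫ᵛ x, φ x ∂<•(z t) =
      ∫ᵛ x, φ x ∂<•z₀ + ∫ s in (0 : ℝ)..t, ∫ᵛ x, (Δ (φ : E d → ℝ)) x * a s x ∂<•(z s)

/-- `u ∈ L¹_loc([0,T] × ℝ^d)` and, for almost every `t ∈ [0,T]`, the signed measure `z(t)` has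
density `u(t, ·)` with respect to Lebesgue measure. -/
structure HasSpaceTimeDensity {d : ℕ} (T : ℝ) (z : ℝ → SignedMeasure (E d))
    (u : ℝ → E d → ℝ) : Prop where
  locallyIntegrable : LocallyIntegrableOn (uncurry u) (Icc 0 T ×ˢ (univ : Set (E d)))
  density : ∀ᵐ t ∂(volume.restrict (Icc 0 T)),
    Integrable (u t) ∧ z t = volume.withDensityᵥ (u t)

/-- Hypothesis (B1): `u` and `a u` belong to `L²([0,T] × ℝ^d)`. -/
structure HypothesisB1 {d : ℕ} (T : ℝ) (a u : ℝ → E d → ℝ) : Prop where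
  density_sq : MemLp (uncurry u) 2 (volume.restrict (Icc 0 T ×ˢ (univ : Set (E d))))
  flux_sq : MemLp (uncurry fun t x => a t x * u t x) 2
    (volume.restrict (Icc 0 T ×ˢ (univ : Set (E d))))

/-- Hypothesis (B2): `d = 1`, `u` and `a u` belong to `L²([t₀,T] × ℝ)` for every `t₀ > 0`, and
`a u` belongs to `L¹([0,T] × ℝ)`. -/
structure HypothesisB2 {d : ℕ} (T : ℝ) (a u : ℝ → E d → ℝ) : Prop where
  dim_one : d = 1
  density_sq : ∀ t₀ : ℝ, 0 < t₀ →
    MemLp (uncurry u) 2 (volume.restrict (Icc t₀ T ×ˢ (univ : Set (E d))))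
  flux : MemLp (uncurry fun t x => a t x * u t x) 1
    (volume.restrict (Icc 0 T ×ˢ (univ : Set (E d))))
  flux_sq : ∀ t₀ : ℝ, 0 < t₀ →
    MemLp (uncurry fun t x => a t x * u t x) 2
      (volume.restrict (Icc t₀ T ×ˢ (univ : Set (E d))))

/-- Hypothesis (B): `z` has a locally integrable space-time density `u` that satisfies (B1) or
(B2). -/
def HypothesisB {d : ℕ} (T : ℝ) (a : ℝ → E d → ℝ) (z : ℝ → SignedMeasure (E d)) : Prop :=
  ∃ u : ℝ → E d → ℝ, HasSpaceTimeDensity T z u ∧ (HypothesisB1 T a u ∨ HypothesisB2 T a u)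

end FokkerPlanck

end

/-!
The difference `w = z₁ - z₂` solves `∂ₜ w = Δ h` with zero initial value, where `u` is the density
of `w` and `h = a u` is the flux. The proof is the energy estimate in the homogeneous Sobolev space
of order `-1`, carried out frequency by frequency. Write `f(s, ξ)` for the Fourier transform of
`h(s)` and `G(t, ξ) = ∫₀ᵗ f(s, ξ) ds`. The weak formulation says that the Fourier transform of
`u(t)` is `-(2π)²|ξ|² G(t, ξ)` for almost every `(t, ξ)` (`IsFluxTransform.fourier_eq`). For almost every
`ξ` the function `t ↦ G(t, ξ)` is absolutely continuous, so `|G|²` is the integral of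
`2 Re (conj G · f)`; multiplying by `(2π)²|ξ|²`, integrating in `ξ` and using Plancherel gives

  `(2π)² ∫ |ξ|² |G(t)|² dξ = (2π)² ∫ |ξ|² |G(t₀)|² dξ - 2 ∫_{t₀}^{t} ∫ u h dx ds`,

and `u h = a u² ≥ 0` (`energy_inequality`, `IsDissipativeSolution.energy_le`).

Under (B1) the flux is only square integrable, so `f` is a partial Fourier transform in `L²`
(`exists_partialFourier`); the estimate with `t₀ = 0` and `G(0) = 0` gives `G = 0`.

Under (B2) the flux is integrable and `f` is a classical Fourier transform, but Plancherel is only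
available for `t₀ > 0`. Let `t₀ → 0`: `G(t₀)` is bounded by the `L¹` norm of the flux, and
`|ξ|² G(t₀)` is bounded because `w` is bounded in total variation, by the uniform boundedness principle
(`exists_norm_fourier_le`). Hence `|ξ|² |G(t₀)|²` is dominated by a multiple of `(1 + |ξ|²)⁻¹`,
which is integrable in dimension one, and it tends to zero pointwise.

In both cases `u(t) = 0` for almost every `t`, and weak continuity extends `w(t) = 0` to every `t`.
-/

namespace FokkerPlanck

open Filter Topology FourierTransform
open scoped ENNReal NNReal Real ComplexConjugate

/-! ### Integration against signed measures -/

section SignedMeasure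

variable {X : Type*} [MeasurableSpace X]

instance isFiniteMeasure_variation (μ : SignedMeasure X) : IsFiniteMeasure μ.variation := by
  rw [← SignedMeasure.totalVariation_eq_variation]; infer_instance

theorem integrable_variation_sub {μ ν : SignedMeasure X} {f : X → ℝ}
    (hμ : μ.Integrable f) (hν : ν.Integrable f) : (μ - ν).Integrable f :=
  (hμ.add_measure hν).mono_measure VectorMeasure.variation_sub_le

theorem integral_withDensityᵥ {ν : Measure X} {u : X → ℝ} (hu : Integrable u ν) {f : X → ℝ}
    (hf : (ν.withDensityᵥ u).Integrable f) :
    ∫ᵛ x, f x ∂<•(ν.withDensityᵥ u) = ∫ x, f x * u x ∂ν := by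
  have hfin := isFiniteMeasure_withDensity_ofReal hu.2
  have hfin' := isFiniteMeasure_withDensity_ofReal hu.neg.2
  have hf' : Integrable f (ν.withDensity fun x => ‖u x‖ₑ) := by
    rw [← Measure.variation_withDensityᵥ hu]; exact hf
  -- Applied to `u` and to `-u`, this treats the positive and negative parts of `u`.
  have key : ∀ v : X → ℝ, AEMeasurable v ν → (∀ x, ENNReal.ofReal (v x) ≤ ‖u x‖ₑ) →
      Integrable f (ν.withDensity fun x => ENNReal.ofReal (v x)) ∧
      Integrable (fun x => (ENNReal.ofReal (v x)).toReal • f x) ν ∧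
      ∫ x, f x ∂(ν.withDensity fun x => ENNReal.ofReal (v x)) =
        ∫ x, (ENNReal.ofReal (v x)).toReal • f x ∂ν := by
    intro v hv hle
    have hi := hf'.mono_measure (withDensity_mono (Eventually.of_forall hle))
    refine ⟨hi, ?_, ?_⟩
    · exact (integrable_withDensity_iff_integrable_smul₀' hv.ennreal_ofReal (by simp)).1 hi
    · exact integral_withDensity_eq_integral_toReal_smul₀ hv.ennreal_ofReal (by simp) f
  obtain ⟨h1, h2, h3⟩ := key u hu.aemeasurable fun x => by
    rw [← ofReal_norm]; exact ENNReal.ofReal_le_ofReal (le_abs_self _)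
  obtain ⟨h1', h2', h3'⟩ := key (-u) hu.neg.aemeasurable fun x => by
    rw [← ofReal_norm]; exact ENNReal.ofReal_le_ofReal (neg_le_abs _)
  have heq : (fun x => f x * u x) = fun x =>
      (ENNReal.ofReal (u x)).toReal • f x - (ENNReal.ofReal ((-u) x)).toReal • f x := by
    funext x
    simp only [ENNReal.toReal_ofReal', smul_eq_mul, Pi.neg_apply]
    rcases le_total 0 (u x) with h | h
    · rw [max_eq_left h, max_eq_right (by linarith)]; ring
    · rw [max_eq_right h, max_eq_left (by linarith)]; ring
  rw [heq, integral_sub h2 h2', ← h3, ← h3',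
    withDensityᵥ_eq_withDensity_pos_part_sub_withDensity_neg_part hu,
    VectorMeasure.integral_sub_vectorMeasure, VectorMeasure.integral_toSignedMeasure,
    VectorMeasure.integral_toSignedMeasure]
  · rfl
  · rwa [VectorMeasure.Integrable, Measure.variation_toSignedMeasure]
  · rwa [VectorMeasure.Integrable, Measure.variation_toSignedMeasure]

theorem _root_.BoundedContinuousFunction.integrable_variation [TopologicalSpace X] [BorelSpace X]
    (μ : SignedMeasure X) (f : X →ᵇ ℝ) : μ.Integrable f :=
  f.integrable _

/-- Integration of bounded continuous functions against a signed measure, as a continuous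
functional. -/
noncomputable def integralBCF [TopologicalSpace X] [BorelSpace X]
    (μ : SignedMeasure X) : (X →ᵇ ℝ) →L[ℝ] ℝ :=
  LinearMap.mkContinuous
    { toFun f := ∫ᵛ x, f x ∂<•μ
      map_add' f g := VectorMeasure.integral_add (f.integrable_variation μ)
        (g.integrable_variation μ)
      map_smul' c f := VectorMeasure.integral_smul _ _ _ c }
    (‖(ContinuousLinearMap.lsmul ℝ ℝ (E := ℝ)).flip‖ * μ.variation.real univ) (fun f => by
      have := VectorMeasure.norm_integral_le_of_norm_le_const (μ := μ) (f := f) (C := ‖f‖)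
        (B := (ContinuousLinearMap.lsmul ℝ ℝ).flip) (Eventually.of_forall f.norm_coe_le_norm)
      exact this.trans_eq (by ring))

/-- Signed measures are determined by their integrals of bounded continuous functions. -/
theorem signedMeasure_eq_zero_of_integral_eq_zero [TopologicalSpace X] [HasOuterApproxClosed X]
    [BorelSpace X] {μ : SignedMeasure X} (h : ∀ f : X →ᵇ ℝ, ∫ᵛ x, f x ∂<•μ = 0) : μ = 0 := by
  set p := μ.toJordanDecomposition.posPart
  set n := μ.toJordanDecomposition.negPart
  have hμ : μ = p.toSignedMeasure - n.toSignedMeasure :=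
    μ.toSignedMeasure_toJordanDecomposition.symm
  have hpn : p = n := by
    refine ext_of_forall_integral_eq_of_IsFiniteMeasure fun f => ?_
    have := h f
    rw [hμ, VectorMeasure.integral_sub_vectorMeasure (f.integrable_variation _)
      (f.integrable_variation _), VectorMeasure.integral_toSignedMeasure,
      VectorMeasure.integral_toSignedMeasure] at this
    linarith
  rw [hμ, sub_eq_zero]
  congr 1

end SignedMeasure

variable {d : ℕ} {T : ℝ} {z z₁ z₂ : ℝ → SignedMeasure (E d)}

theorem IsWeaklyContinuous.sub (h₁ : IsWeaklyContinuous T z₁) (h₂ : IsWeaklyContinuous T z₂) :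
    IsWeaklyContinuous T fun t => z₁ t - z₂ t := by
  intro f
  simp_rw [fun t => VectorMeasure.integral_sub_vectorMeasure
    (B := (ContinuousLinearMap.lsmul ℝ ℝ).flip)
    (f.integrable_variation (z₁ t)) (f.integrable_variation (z₂ t))]
  exact (h₁ f).sub (h₂ f)

/-- By weak continuity, vanishing at almost every time implies vanishing at every time. -/
theorem IsWeaklyContinuous.eq_zero_of_ae (hT : 0 < T) (h : IsWeaklyContinuous T z)
    (h0 : ∀ᵐ t ∂(volume.restrict (Icc 0 T)), z t = 0) : ∀ t ∈ Icc 0 T, z t = 0 := by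
  intro t ht
  refine signedMeasure_eq_zero_of_integral_eq_zero fun f => ?_
  refine Measure.eqOn_Icc_of_ae_eq volume hT.ne (f := fun t => ∫ᵛ x, f x ∂<•(z t))
    (g := fun _ => 0) ?_ (h f) continuousOn_const ht
  filter_upwards [h0] with s hs
  simp [hs]

/-- A weakly continuous family of signed measures on a compact interval is bounded, by the
uniform boundedness principle. -/
theorem IsWeaklyContinuous.exists_bound (h : IsWeaklyContinuous T z) :
    ∃ C, ∀ t ∈ Icc 0 T, ∀ f : E d →ᵇ ℝ, ‖∫ᵛ x, f x ∂<•(z t)‖ ≤ C * ‖f‖ := by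
  obtain ⟨C, hC⟩ := banach_steinhaus (g := fun t : Icc 0 T => integralBCF (z t)) fun f => by
    obtain ⟨C, hC⟩ := isCompact_Icc.exists_bound_of_continuousOn (h f)
    exact ⟨C, fun t => hC t t.2⟩
  exact ⟨C, fun t ht f => (integralBCF (z t)).le_of_opNorm_le (hC ⟨t, ht⟩) f⟩

/-! ### The Fourier transform on `L¹ ∩ L²` -/

section Fourier

variable {V : Type*} [NormedAddCommGroup V] [InnerProductSpace ℝ V] [FiniteDimensional ℝ V]
  [MeasurableSpace V] [BorelSpace V]

/-- The Laplacian of a Fourier transform is the Fourier transform of the multiplication by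
`-(2π)²|ξ|²`. -/
theorem laplacian_fourier (ψ : 𝓢(V, ℂ)) :
    Δ (𝓕 ψ) = 𝓕 (-(2 * π) ^ 2 • SchwartzMap.smulLeftCLM ℂ (fun ξ : V => ‖ξ‖ ^ 2) ψ) := by
  let b := stdOrthonormalBasis ℝ V
  have hb : ∀ m : V, (inner ℝ · m : V → ℝ).HasTemperateGrowth := by fun_prop
  rw [SchwartzMap.laplacian_eq_sum b]
  simp_rw [SchwartzMap.lineDerivOp_fourier_eq]
  have : ∑ i, 𝓕 (-(2 * π * Complex.I) • SchwartzMap.smulLeftCLM ℂ (inner ℝ · (b i))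
      (-(2 * π * Complex.I) • SchwartzMap.smulLeftCLM ℂ (inner ℝ · (b i)) ψ)) =
      𝓕 (∑ i, (-(2 * π * Complex.I) • SchwartzMap.smulLeftCLM ℂ (inner ℝ · (b i))
      (-(2 * π * Complex.I) • SchwartzMap.smulLeftCLM ℂ (inner ℝ · (b i)) ψ))) := by
    exact (map_sum (fourierCLM ℂ 𝓢(V, ℂ)) _ _).symm
  rw [this]
  congr 1
  ext ξ
  have h2 : (fun ξ : V => ‖ξ‖ ^ 2).HasTemperateGrowth := by fun_prop
  rw [sum_apply, smul_apply, SchwartzMap.smulLeftCLM_apply_apply h2,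
    ← b.sum_sq_inner_left ξ, Finset.sum_smul, Finset.smul_sum]
  refine Finset.sum_congr rfl fun i _ => ?_
  simp only [smul_apply, SchwartzMap.smulLeftCLM_apply_apply (hb _), smul_eq_mul,
    Complex.real_smul]
  push_cast
  ring_nf
  simp

/-- The Fourier transform is self-adjoint for the pairing of an integrable function with a Schwartz
function. -/
theorem integral_mul_fourier {f : V → ℂ} (hf : Integrable f) (ψ : 𝓢(V, ℂ)) :
    ∫ ξ, ψ ξ * 𝓕 f ξ = ∫ x, 𝓕 ψ x * f x := by
  have := VectorFourier.integral_fourierIntegral_smul_eq_flip (L := innerₗ V)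
    Real.continuous_fourierChar continuous_inner (μ := volume) (ν := volume) hf (ψ.integrable)
  simp only [flip_innerₗ, smul_eq_mul] at this
  simp_rw [mul_comm (ψ _), mul_comm (𝓕 ψ _)]
  exact this

/-- Locally integrable functions are determined by their integrals against compactly supported
Schwartz functions. -/
theorem ae_eq_of_integral_schwartz {f g : V → ℂ} (hf : LocallyIntegrable f)
    (hg : LocallyIntegrable g)
    (h : ∀ ψ : 𝓢(V, ℂ), HasCompactSupport ψ → ∫ ξ, ψ ξ * f ξ = ∫ ξ, ψ ξ * g ξ) :
    f =ᵐ[volume] g := by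
  refine ae_eq_of_integral_contDiff_smul_eq hf hg fun η hη hηc => ?_
  have hc : HasCompactSupport fun x => (η x : ℂ) := hηc.comp_left (g := ((↑) : ℝ → ℂ)) rfl
  exact h (hc.toSchwartzMap (Complex.ofRealCLM.contDiff.comp hη)) hc

theorem continuous_fourier {f : V → ℂ} (hf : Integrable f) : Continuous (𝓕 f) :=
  VectorFourier.fourierIntegral_continuous Real.continuous_fourierChar continuous_inner hf

theorem norm_fourier_le (f : V → ℂ) (ξ : V) : ‖𝓕 f ξ‖ ≤ ∫ x, ‖f x‖ :=
  VectorFourier.norm_fourierIntegral_le_integral_norm _ _ _ _ _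

/-- On `L¹ ∩ L²` the Fourier integral is the Fourier transform of `L²`. -/
theorem fourier_toLp_ae_eq {f : V → ℂ} (hf : Integrable f) (hf2 : MemLp f 2) :
    ((𝓕 (hf2.toLp f) : Lp ℂ 2 (volume : Measure V)) : V → ℂ) =ᵐ[volume] 𝓕 f := by
  refine ae_eq_of_integral_schwartz ((Lp.memLp _).locallyIntegrable one_le_two)
    (continuous_fourier hf).locallyIntegrable fun ψ _ => ?_
  rw [integral_mul_fourier hf]
  have h := congrArg (fun L : 𝓢'(V, ℂ) => L ψ) (Lp.fourier_toTemperedDistribution_eq (hf2.toLp f))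
  simp only [TemperedDistribution.fourier_apply, Lp.toTemperedDistribution_apply, smul_eq_mul] at h
  rw [← h]
  refine integral_congr_ae ?_
  filter_upwards [hf2.coeFn_toLp] with x hx
  rw [hx]

theorem memLp_fourier {f : V → ℂ} (hf : Integrable f) (hf2 : MemLp f 2) : MemLp (𝓕 f) 2 :=
  (memLp_congr_ae (fourier_toLp_ae_eq hf hf2)).1 (Lp.memLp _)

/-- Plancherel's theorem on `L¹ ∩ L²`. -/
theorem integral_conj_fourier_mul_fourier {f g : V → ℂ} (hf : Integrable f) (hf2 : MemLp f 2)
    (hg : Integrable g) (hg2 : MemLp g 2) :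
    ∫ ξ, conj (𝓕 f ξ) * 𝓕 g ξ = ∫ x, conj (f x) * g x := by
  have h := Lp.inner_fourier_eq (hf2.toLp f) (hg2.toLp g)
  rw [L2.inner_def, L2.inner_def] at h
  calc _ = _ := integral_congr_ae ?_
    _ = _ := h
    _ = _ := integral_congr_ae ?_
  · filter_upwards [fourier_toLp_ae_eq hf hf2, fourier_toLp_ae_eq hg hg2] with x h1 h2
    rw [h1, h2, RCLike.inner_apply, mul_comm]
  · filter_upwards [hf2.coeFn_toLp, hg2.coeFn_toLp] with x h1 h2
    rw [h1, h2, RCLike.inner_apply, mul_comm]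

/-- The Fourier transform is injective on integrable functions. -/
theorem ae_eq_zero_of_fourier_ae_eq_zero {f : V → ℂ} (hf : Integrable f)
    (h : 𝓕 f =ᵐ[volume] 0) : f =ᵐ[volume] 0 := by
  refine ae_eq_of_integral_schwartz hf.locallyIntegrable (integrable_zero _ _ _).locallyIntegrable
    fun ψ _ => ?_
  have := integral_mul_fourier hf (𝓕⁻ ψ)
  rw [FourierTransform.fourier_fourierInv_eq] at this
  rw [← this]
  refine integral_congr_ae ?_
  filter_upwards [h] with x hx
  simp [hx]

variable {α : Type*} [MeasurableSpace α] {μ : Measure α}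

theorem stronglyMeasurable_fourier {g : α → V → ℂ} (hg : StronglyMeasurable (uncurry g)) :
    StronglyMeasurable (uncurry fun s ξ => 𝓕 (g s) ξ) := by
  have : StronglyMeasurable fun q : (α × V) × V => Real.fourierChar (-(inner ℝ q.2 q.1.2)) •
      g q.1.1 q.2 := by
    have h1 : Continuous fun q : V × V => Real.fourierChar (-(inner ℝ q.2 q.1)) := by
      exact Real.continuous_fourierChar.comp (by fun_prop)
    have h2 : StronglyMeasurable fun q : (α × V) × V =>
        ((Real.fourierChar (-(inner ℝ q.2 q.1.2)) : Circle) : ℂ) :=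
      ((continuous_subtype_val.comp h1).stronglyMeasurable).comp_measurable
        (g := fun q : (α × V) × V => (q.1.2, q.2)) (by fun_prop)
    have h3 : StronglyMeasurable fun q : (α × V) × V => g q.1.1 q.2 :=
      hg.comp_measurable (g := fun q : (α × V) × V => (q.1.1, q.2)) (by fun_prop)
    exact h2.mul h3
  exact this.integral_prod_right

end Fourier

/-! ### The partial Fourier transform in `L²` -/

section PartialFourier

variable {V : Type*} [NormedAddCommGroup V] [InnerProductSpace ℝ V] [FiniteDimensional ℝ V]
  [MeasurableSpace V] [BorelSpace V] {α : Type*} [MeasurableSpace α] {μ : Measure α}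

theorem eLpNorm_fourier {f : V → ℂ} (hf : Integrable f) (hf2 : MemLp f 2) :
    eLpNorm (𝓕 f) 2 = eLpNorm f 2 := by
  have h := congrArg ENNReal.ofReal (Lp.norm_fourier_eq (hf2.toLp f))
  rw [ofReal_norm, ofReal_norm, Lp.enorm_toLp, Lp.enorm_def,
    eLpNorm_congr_ae (fourier_toLp_ae_eq hf hf2)] at h
  exact h

/-- The functions to which the partial Fourier transform in the second variable applies
classically: square integrable, with almost all sections integrable. -/
structure MemL2SectionL1 (μ : Measure α) (g : α → V → ℂ) : Prop where
  stronglyMeasurable : StronglyMeasurable (uncurry g)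
  memLp : MemLp (uncurry g) 2 (μ.prod volume)
  section_integrable : ∀ᵐ s ∂μ, Integrable (g s)

variable {g g₁ g₂ : α → V → ℂ}

theorem eLpNorm_two_sq {β : Type*} [MeasurableSpace β] {ν : Measure β} (f : β → ℂ) :
    eLpNorm f 2 ν ^ 2 = ∫⁻ x, ‖f x‖ₑ ^ 2 ∂ν := by
  rw [eLpNorm_eq_lintegral_rpow_enorm_toReal (by simp) (by simp)]
  simp only [ENNReal.toReal_ofNat, ENNReal.rpow_ofNat, one_div]
  rw [← ENNReal.rpow_natCast, ← ENNReal.rpow_mul]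
  norm_num

theorem MemL2SectionL1.section_memLp (hg : MemL2SectionL1 μ g) :
    ∀ᵐ s ∂μ, MemLp (g s) 2 := by
  have h : ∫⁻ p, ‖uncurry g p‖ₑ ^ 2 ∂(μ.prod volume) ≠ ∞ := by
    rw [← eLpNorm_two_sq]; exact ENNReal.pow_ne_top hg.memLp.2.ne
  rw [lintegral_prod _ (hg.stronglyMeasurable.enorm.pow_const 2).aemeasurable] at h
  filter_upwards [ae_lt_top (hg.stronglyMeasurable.enorm.pow_const 2).lintegral_prod_right' h]
    with s hs
  refine ⟨(hg.stronglyMeasurable.comp_measurable measurable_prodMk_left).aestronglyMeasurable, ?_⟩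
  have : eLpNorm (g s) 2 volume ^ 2 < ∞ := by rw [eLpNorm_two_sq]; exact hs
  exact (ENNReal.pow_lt_top_iff.1 this).resolve_right (by simp)

theorem MemL2SectionL1.sub (h₁ : MemL2SectionL1 μ g₁) (h₂ : MemL2SectionL1 μ g₂) :
    MemL2SectionL1 μ (g₁ - g₂) where
  stronglyMeasurable := h₁.stronglyMeasurable.sub h₂.stronglyMeasurable
  memLp := h₁.memLp.sub h₂.memLp
  section_integrable := by
    filter_upwards [h₁.section_integrable, h₂.section_integrable] with s a b using a.sub b

theorem MemL2SectionL1.eLpNorm_fourier (hg : MemL2SectionL1 μ g) :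
    eLpNorm (uncurry fun s ξ => 𝓕 (g s) ξ) 2 (μ.prod volume) =
      eLpNorm (uncurry g) 2 (μ.prod volume) := by
  have : eLpNorm (uncurry fun s ξ => 𝓕 (g s) ξ) 2 (μ.prod volume) ^ 2 =
      eLpNorm (uncurry g) 2 (μ.prod volume) ^ 2 := by
    rw [eLpNorm_two_sq, eLpNorm_two_sq,
      lintegral_prod _
        ((stronglyMeasurable_fourier hg.stronglyMeasurable).enorm.pow_const 2).aemeasurable,
      lintegral_prod _ (hg.stronglyMeasurable.enorm.pow_const 2).aemeasurable]
    refine lintegral_congr_ae ?_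
    filter_upwards [hg.section_integrable, hg.section_memLp] with s h1 h2
    simp only [uncurry_apply_pair]
    rw [← eLpNorm_two_sq, ← eLpNorm_two_sq, FokkerPlanck.eLpNorm_fourier h1 h2]
  exact (ENNReal.pow_right_strictMono two_ne_zero).injective this

theorem MemL2SectionL1.memLp_fourier (hg : MemL2SectionL1 μ g) :
    MemLp (uncurry fun s ξ => 𝓕 (g s) ξ) 2 (μ.prod volume) :=
  ⟨(stronglyMeasurable_fourier hg.stronglyMeasurable).aestronglyMeasurable, by
    rw [hg.eLpNorm_fourier]; exact hg.memLp.2⟩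

theorem MemL2SectionL1.eLpNorm_fourier_sub (h₁ : MemL2SectionL1 μ g₁)
    (h₂ : MemL2SectionL1 μ g₂) :
    eLpNorm ((uncurry fun s ξ => 𝓕 (g₁ s) ξ) - uncurry fun s ξ => 𝓕 (g₂ s) ξ) 2 (μ.prod volume) =
      eLpNorm (uncurry g₁ - uncurry g₂) 2 (μ.prod volume) := by
  have h := (h₁.sub h₂).eLpNorm_fourier
  have hae : ((uncurry fun s ξ => 𝓕 (g₁ s) ξ) - uncurry fun s ξ => 𝓕 (g₂ s) ξ)
      =ᵐ[μ.prod volume] uncurry fun s ξ => 𝓕 ((g₁ - g₂) s) ξ := by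
    refine (Measure.ae_prod_iff_ae_ae ?_).2 ?_
    · exact measurableSet_eq_fun
        ((stronglyMeasurable_fourier h₁.stronglyMeasurable).sub
          (stronglyMeasurable_fourier h₂.stronglyMeasurable)).measurable
        (stronglyMeasurable_fourier (h₁.sub h₂).stronglyMeasurable).measurable
    · filter_upwards [h₁.section_integrable, h₂.section_integrable] with s a b
      refine Eventually.of_forall fun ξ => ?_
      simp only [Pi.sub_apply, uncurry_apply_pair]
      simp only [Real.fourier_eq, Pi.sub_apply, smul_sub]
      rw [integral_sub]
      · exact (Real.fourierIntegral_convergent_iff ξ).2 a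
      · exact (Real.fourierIntegral_convergent_iff ξ).2 b
  rw [eLpNorm_congr_ae hae, h]
  rfl

variable [SFinite μ]

/-- Plancherel's theorem for the partial Fourier transform. -/
theorem MemL2SectionL1.integral_conj_fourier_mul_fourier (h₁ : MemL2SectionL1 μ g₁)
    (h₂ : MemL2SectionL1 μ g₂) :
    ∫ p, conj (𝓕 (g₁ p.1) p.2) * 𝓕 (g₂ p.1) p.2 ∂(μ.prod volume) =
      ∫ p, conj (g₁ p.1 p.2) * g₂ p.1 p.2 ∂(μ.prod volume) := by
  rw [integral_prod, integral_prod]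
  · refine integral_congr_ae ?_
    filter_upwards [h₁.section_integrable, h₁.section_memLp, h₂.section_integrable,
      h₂.section_memLp] with s a1 a2 a3 a4
    exact FokkerPlanck.integral_conj_fourier_mul_fourier a1 a2 a3 a4
  · exact h₁.memLp.star.integrable_mul h₂.memLp
  · exact h₁.memLp_fourier.star.integrable_mul h₂.memLp_fourier

/-- Integrals against a fixed square integrable function are continuous for `L²` convergence. -/
theorem tendsto_setIntegral_mul_of_tendsto_eLpNorm {β : Type*} [MeasurableSpace β] {ν : Measure β}
    {φ f : β → ℂ} {F : ℕ → β → ℂ} (hφ : MemLp φ 2 ν) (hf : MemLp f 2 ν)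
    (hF : ∀ n, MemLp (F n) 2 ν) (h : Tendsto (fun n => eLpNorm (F n - f) 2 ν) atTop (𝓝 0))
    (S : Set β) :
    Tendsto (fun n => ∫ x in S, φ x * F n x ∂ν) atTop (𝓝 (∫ x in S, φ x * f x ∂ν)) := by
  have hb : ∀ n, eLpNorm (fun x => φ x * F n x - φ x * f x) 1 (ν.restrict S) ≤
      eLpNorm φ 2 ν * eLpNorm (F n - f) 2 ν := by
    intro n
    calc _ = eLpNorm (φ • (F n - f)) 1 (ν.restrict S) := by
            congr 1; ext x; simp [mul_sub]
      _ ≤ eLpNorm φ 2 (ν.restrict S) * eLpNorm (F n - f) 2 (ν.restrict S) :=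
          eLpNorm_smul_le_mul_eLpNorm (((hF n).sub hf).1.restrict) hφ.1.restrict
      _ ≤ _ := mul_le_mul' (eLpNorm_mono_measure _ Measure.restrict_le_self)
          (eLpNorm_mono_measure _ Measure.restrict_le_self)
  refine tendsto_integral_of_L1' _ ((hφ.integrable_mul hf).restrict (s := S)).1
    (Eventually.of_forall fun n => (hφ.integrable_mul (hF n)).restrict) ?_
  refine tendsto_of_tendsto_of_tendsto_of_le_of_le tendsto_const_nhds ?_ (fun _ => zero_le)
    hb
  simpa using ENNReal.Tendsto.const_mul h (Or.inr hφ.2.ne)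

/-- Square integrable functions on `ℝ × V` have a partial Fourier transform in `L²`, in the sense
that every duality relation satisfied by the classical partial Fourier transform passes to them.
Both the duality with Schwartz functions and Plancherel's formula are of this form. -/
theorem exists_partialFourier {μ : Measure ℝ} [IsFiniteMeasure μ] {h : ℝ × V → ℂ}
    (hh : MemLp h 2 (μ.prod volume)) :
    ∃ f : ℝ → V → ℂ, StronglyMeasurable (uncurry f) ∧ MemLp (uncurry f) 2 (μ.prod volume) ∧
      ∀ (S : Set (ℝ × V)) (φ₁ φ₂ : ℝ × V → ℂ), MemLp φ₁ 2 (μ.prod volume) →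
        MemLp φ₂ 2 (μ.prod volume) →
        (∀ g : ℝ → V → ℂ, MemL2SectionL1 μ g →
          ∫ p in S, φ₁ p * 𝓕 (g p.1) p.2 ∂(μ.prod volume) =
            ∫ p in S, φ₂ p * g p.1 p.2 ∂(μ.prod volume)) →
        ∫ p in S, φ₁ p * f p.1 p.2 ∂(μ.prod volume) = ∫ p in S, φ₂ p * h p ∂(μ.prod volume) := by
  -- Continuous functions with compact support are classical and dense, and the partial transform is
  -- isometric on classical functions, so the transforms of an approximating sequence converge.
  have hex : ∀ n : ℕ, ∃ g : ℝ → V → ℂ, MemL2SectionL1 μ g ∧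
      eLpNorm (uncurry g - h) 2 (μ.prod volume) ≤ (2 : ℝ≥0∞)⁻¹ ^ n := by
    intro n
    obtain ⟨g, hgc, hgn, hgcont, hgm⟩ := hh.exists_hasCompactSupport_eLpNorm_sub_le (by simp)
      (ε := (2 : ℝ≥0∞)⁻¹ ^ n) (by simp)
    refine ⟨Function.curry g, ⟨by simpa using hgcont.stronglyMeasurable, by simpa using hgm, ?_⟩,
      ?_⟩
    · refine Eventually.of_forall fun s => ?_
      refine Continuous.integrable_of_hasCompactSupport (by unfold Function.curry; fun_prop) ?_
      refine HasCompactSupport.intro (K := Prod.snd '' tsupport g)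
        (hgc.isCompact.image continuous_snd) fun x hx => ?_
      by_contra hne
      exact hx ⟨(s, x), subset_tsupport _ hne, rfl⟩
    · rw [uncurry_curry, eLpNorm_sub_comm]; exact hgn
  choose g hg hgn using hex
  have hlim : Tendsto (fun n => eLpNorm (uncurry (g n) - h) 2 (μ.prod volume)) atTop (𝓝 0) :=
    tendsto_of_tendsto_of_tendsto_of_le_of_le tendsto_const_nhds
      (ENNReal.tendsto_pow_atTop_nhds_zero_of_lt_one (by simp)) (fun _ => zero_le) hgn
  let G : ℕ → Lp ℂ 2 (μ.prod (volume : Measure V)) := fun n => (hg n).memLp_fourier.toLp _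
  have hcau : CauchySeq G := by
    have hcau' : CauchySeq fun n => (hg n).memLp.toLp (uncurry (g n)) :=
      ((Lp.tendsto_Lp_iff_tendsto_eLpNorm'' _ (fun n => (hg n).memLp) _ hh).2 hlim).cauchySeq
    rw [EMetric.cauchySeq_iff] at hcau' ⊢
    intro ε hε
    obtain ⟨N, hN⟩ := hcau' ε hε
    refine ⟨N, fun m hm n hn => ?_⟩
    have := hN m hm n hn
    rw [Lp.edist_toLp_toLp] at this ⊢
    rwa [(hg m).eLpNorm_fourier_sub (hg n)]
  obtain ⟨F, hF⟩ := cauchySeq_tendsto_of_complete hcau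
  have hFm := Lp.memLp F
  have hFG : Tendsto (fun n => eLpNorm ((uncurry fun s ξ => 𝓕 (g n s) ξ) - (F : ℝ × V → ℂ)) 2
      (μ.prod volume)) atTop (𝓝 0) := by
    refine (Lp.tendsto_Lp_iff_tendsto_eLpNorm'' _ (fun n => (hg n).memLp_fourier) _ hFm).1 ?_
    simpa using hF
  refine ⟨Function.curry F, by simpa using Lp.stronglyMeasurable F, by simpa using hFm, ?_⟩
  intro S φ₁ φ₂ h1 h2 heq
  have t1 := tendsto_setIntegral_mul_of_tendsto_eLpNorm h1 hFm (fun n => (hg n).memLp_fourier)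
    hFG S
  have t2 := tendsto_setIntegral_mul_of_tendsto_eLpNorm h2 hh (fun n => (hg n).memLp) hlim S
  refine tendsto_nhds_unique t1 (t2.congr fun n => ?_)
  exact (heq _ (hg n)).symm

end PartialFourier

/-! ### The energy identity in Fourier variables -/

section Energy

/-- The energy identity for the primitive of an integrable real function, which holds because the
primitive is absolutely continuous. -/
theorem sq_integral_sub_sq_integral {f : ℝ → ℝ} {t₀ t : ℝ} (h0 : 0 ≤ t₀) (ht : t₀ ≤ t)
    (hf : IntegrableOn f (Ioc 0 t)) :
    IntegrableOn (fun s => (∫ r in Ioc 0 s, f r) * f s) (Ioc t₀ t) ∧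
    (∫ s in Ioc 0 t, f s) ^ 2 - (∫ s in Ioc 0 t₀, f s) ^ 2 =
      2 * ∫ s in Ioc t₀ t, (∫ r in Ioc 0 s, f r) * f s := by
  have hi : IntervalIntegrable f volume 0 t :=
    (intervalIntegrable_iff_integrableOn_Ioc_of_le (h0.trans ht)).2 hf
  have hac := (hi.absolutelyContinuousOnInterval_intervalIntegral (c := 0) (by simp)).mono
    (c := t₀) (d := t) (by
      rw [uIcc_of_le ht, uIcc_of_le (h0.trans ht)]; exact Icc_subset_Icc_left h0)
  have hval : ∀ s, 0 ≤ s → ∫ r in Ioc 0 s, f r = ∫ r in (0 : ℝ)..s, f r := fun s hs =>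
    (intervalIntegral.integral_of_le hs).symm
  have hi' : IntegrableOn (fun s => (∫ r in (0 : ℝ)..s, f r) * f s) (Ioc t₀ t) := by
    have hi2 : IntervalIntegrable f volume t₀ t :=
      (intervalIntegrable_iff_integrableOn_Ioc_of_le ht).2
        (hf.mono_set (Ioc_subset_Ioc_left h0))
    exact (intervalIntegrable_iff_integrableOn_Ioc_of_le ht).1
      (hi2.continuousOn_mul hac.continuousOn)
  refine ⟨hi'.congr_fun (fun s hs => ?_) measurableSet_Ioc, ?_⟩
  · simp only [hval s (h0.trans hs.1.le)]
  have h := AbsolutelyContinuousOnInterval.integral_deriv_mul_eq_sub hac hac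
  rw [hval _ h0, hval _ (h0.trans ht), sq, sq, ← h, intervalIntegral.integral_of_le ht,
    ← integral_const_mul]
  refine setIntegral_congr_ae measurableSet_Ioc ?_
  filter_upwards [hi.ae_hasDerivAt_integral] with s hs hmem
  have hs' : s ∈ uIcc 0 t := by
    rw [uIcc_of_le (h0.trans ht)]; exact ⟨h0.trans hmem.1.le, hmem.2⟩
  rw [(hs hs' 0 (by simp)).deriv, hval s (h0.trans hmem.1.le)]
  ring

/-- The energy identity for the primitive of an integrable complex function. -/
theorem normSq_integral_sub_normSq_integral {f : ℝ → ℂ} {t₀ t : ℝ} (h0 : 0 ≤ t₀) (ht : t₀ ≤ t)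
    (hf : IntegrableOn f (Ioc 0 t)) :
    ‖∫ s in Ioc 0 t, f s‖ ^ 2 - ‖∫ s in Ioc 0 t₀, f s‖ ^ 2 =
      2 * ∫ s in Ioc t₀ t, (conj (∫ r in Ioc 0 s, f r) * f s).re := by
  have hre := sq_integral_sub_sq_integral h0 ht hf.re
  have him := sq_integral_sub_sq_integral h0 ht hf.im
  have key : ∀ s, 0 ≤ s → s ≤ t →
      (∫ r in Ioc 0 s, f r).re = ∫ r in Ioc 0 s, (f r).re ∧
      (∫ r in Ioc 0 s, f r).im = ∫ r in Ioc 0 s, (f r).im := fun s hs hst =>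
    ⟨(integral_re (hf.mono_set (Ioc_subset_Ioc_right hst))).symm,
      (integral_im (hf.mono_set (Ioc_subset_Ioc_right hst))).symm⟩
  have e : ∫ s in Ioc t₀ t, (conj (∫ r in Ioc 0 s, f r) * f s).re =
      ∫ s in Ioc t₀ t, ((∫ r in Ioc 0 s, (f r).re) * (f s).re +
        (∫ r in Ioc 0 s, (f r).im) * (f s).im) := by
    refine setIntegral_congr_fun measurableSet_Ioc fun s hs => ?_
    rw [Complex.mul_re, Complex.conj_re, Complex.conj_im, (key s (h0.trans hs.1.le) hs.2).1,
      (key s (h0.trans hs.1.le) hs.2).2]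
    ring
  have hadd := integral_add hre.1 him.1
  simp only [RCLike.re_to_complex, RCLike.im_to_complex] at hre him hadd
  rw [e, hadd, mul_add, ← hre.2, ← him.2, Complex.sq_norm, Complex.sq_norm, Complex.normSq_apply,
    Complex.normSq_apply, (key t (h0.trans ht) le_rfl).1, (key t (h0.trans ht) le_rfl).2,
    (key t₀ h0 ht).1, (key t₀ h0 ht).2]
  ring

/-- The primitive in time, vanishing at time `0`, of a function of time and space. -/
noncomputable def timePrimitive {X : Type*} (f : ℝ → X → ℂ) (t : ℝ) (ξ : X) : ℂ :=
  ∫ s in Ioc 0 t, f s ξ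

theorem stronglyMeasurable_timePrimitive {X : Type*} [MeasurableSpace X] {f : ℝ → X → ℂ}
    (hf : StronglyMeasurable (uncurry f)) :
    StronglyMeasurable (uncurry (timePrimitive f)) := by
  -- With the indicator of `0 < r ≤ t`, the moving domain of integration becomes a fixed one.
  have h : StronglyMeasurable fun q : (ℝ × X) × ℝ =>
      {q : (ℝ × X) × ℝ | 0 < q.2 ∧ q.2 ≤ q.1.1}.indicator (fun q => f q.2 q.1.2) q := by
    refine StronglyMeasurable.indicator
      (hf.comp_measurable (g := fun q : (ℝ × X) × ℝ => (q.2, q.1.2)) (by fun_prop)) ?_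
    exact (measurableSet_lt measurable_const measurable_snd).inter
      (measurableSet_le measurable_snd (measurable_fst.comp measurable_fst))
  have h' := h.integral_prod_right' (ν := (volume : Measure ℝ))
  convert! h' using 2 with q
  rw [uncurry, timePrimitive, ← integral_indicator measurableSet_Ioc]
  rfl

variable {V : Type*} [NormedAddCommGroup V] [InnerProductSpace ℝ V] [FiniteDimensional ℝ V]
  [MeasurableSpace V] [BorelSpace V]

variable (V) in
/-- Lebesgue measure on the strip `(a,b] × V`. -/
noncomputable abbrev stripMeasure (a b : ℝ) : Measure (ℝ × V) :=
  (volume.restrict (Ioc a b)).prod volume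

theorem stripMeasure_eq_restrict {a b c d : ℝ} (h : Ioc c d ⊆ Ioc a b) :
    (stripMeasure V a b).restrict (Ioc c d ×ˢ univ) = stripMeasure V c d := by
  rw [stripMeasure, ← Measure.prod_restrict, Measure.restrict_univ,
    Measure.restrict_restrict measurableSet_Ioc, inter_eq_left.2 h]

theorem stripMeasure_mono {a b c d : ℝ} (h : Ioc c d ⊆ Ioc a b) :
    stripMeasure V c d ≤ stripMeasure V a b := by
  rw [← stripMeasure_eq_restrict h]; exact Measure.restrict_le_self

/-- The energy inequality in Fourier variables. The Fourier transform `W` of the density is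
`-c|ξ|²` times the time primitive of the Fourier transform `f` of the flux. -/
theorem energy_inequality {T t₀ t c : ℝ} (hc : 0 < c) (h0 : 0 ≤ t₀) (ht : t₀ ≤ t) (htT : t ≤ T)
    {f W : ℝ → V → ℂ}
    (hfi : ∀ᵐ ξ, IntegrableOn (fun s => f s ξ) (Ioc 0 T))
    (hW : ∀ᵐ ξ, ∀ᵐ s ∂(volume.restrict (Ioc 0 T)),
      W s ξ = -(c * ‖ξ‖ ^ 2 : ℝ) * timePrimitive f s ξ)
    (hint : Integrable (fun p => conj (W p.1 p.2) * f p.1 p.2) (stripMeasure V t₀ t))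
    (hpos : 0 ≤ (∫ p, conj (W p.1 p.2) * f p.1 p.2 ∂(stripMeasure V t₀ t)).re)
    (hA : Integrable fun ξ => ‖ξ‖ ^ 2 * ‖timePrimitive f t₀ ξ‖ ^ 2) :
    Integrable (fun ξ => ‖ξ‖ ^ 2 * ‖timePrimitive f t ξ‖ ^ 2) ∧
      ∫ ξ, ‖ξ‖ ^ 2 * ‖timePrimitive f t ξ‖ ^ 2 ≤ ∫ ξ, ‖ξ‖ ^ 2 * ‖timePrimitive f t₀ ξ‖ ^ 2 := by
  have hB : Integrable (fun ξ => ∫ s in Ioc t₀ t, (conj (W s ξ) * f s ξ).re) :=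
    hint.re.integral_prod_right
  have hBpos : 0 ≤ ∫ ξ, ∫ s in Ioc t₀ t, (conj (W s ξ) * f s ξ).re := by
    rw [← RCLike.re_to_complex, ← integral_re hint, integral_prod_symm _ hint.re] at hpos
    exact hpos
  have key : ∀ᵐ ξ, ‖ξ‖ ^ 2 * ‖timePrimitive f t ξ‖ ^ 2 = ‖ξ‖ ^ 2 * ‖timePrimitive f t₀ ξ‖ ^ 2 -
      (2 / c) * ∫ s in Ioc t₀ t, (conj (W s ξ) * f s ξ).re := by
    filter_upwards [hfi, hW] with ξ h1 h2
    have e := normSq_integral_sub_normSq_integral h0 ht (h1.mono_set (Ioc_subset_Ioc_right htT))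
    have e2 : ∫ s in Ioc t₀ t, (conj (W s ξ) * f s ξ).re =
        -(c * ‖ξ‖ ^ 2) * ∫ s in Ioc t₀ t, (conj (∫ r in Ioc 0 s, f r ξ) * f s ξ).re := by
      rw [← integral_const_mul]
      refine integral_congr_ae ?_
      filter_upwards [ae_restrict_of_ae_restrict_of_subset (Ioc_subset_Ioc h0 htT) h2] with s hs
      rw [hs, map_mul, map_neg, Complex.conj_ofReal, timePrimitive, ← Complex.ofReal_neg,
        mul_assoc, Complex.re_ofReal_mul]
    rw [e2]
    simp only [timePrimitive]
    have : ‖∫ s in Ioc 0 t, f s ξ‖ ^ 2 = ‖∫ s in Ioc 0 t₀, f s ξ‖ ^ 2 +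
      2 * ∫ s in Ioc t₀ t, (conj (∫ r in Ioc 0 s, f r ξ) * f s ξ).re := by linarith
    rw [this]
    field_simp
    ring
  refine ⟨(hA.sub (hB.const_mul (2 / c))).congr (key.mono fun ξ h => h.symm), ?_⟩
  rw [integral_congr_ae key, integral_sub hA (hB.const_mul _), integral_const_mul]
  have : 0 ≤ 2 / c * ∫ ξ, ∫ s in Ioc t₀ t, (conj (W s ξ) * f s ξ).re := by positivity
  linarith

/-- The properties of the partial Fourier transform `f` of the flux `h` on `(0,T] × V` that enter
the proof: duality with Schwartz functions and local integrability. -/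
structure IsFluxTransform (T : ℝ) (h f : ℝ → V → ℂ) : Prop where
  stronglyMeasurable : StronglyMeasurable (uncurry f)
  dual : ∀ t ∈ Ioc 0 T, ∀ ψ : 𝓢(V, ℂ), ∫ p, ψ p.2 * f p.1 p.2 ∂(stripMeasure V 0 t) =
    ∫ p, 𝓕 ψ p.2 * h p.1 p.2 ∂(stripMeasure V 0 t)
  integrable_ball : ∀ R : ℝ, Integrable (uncurry f)
    ((volume.restrict (Ioc 0 T)).prod (volume.restrict (Metric.closedBall (0 : V) R)))

theorem IsFluxTransform.ae_integrableOn {T : ℝ} {h f : ℝ → V → ℂ} (hf : IsFluxTransform T h f) :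
    ∀ᵐ ξ, IntegrableOn (fun s => f s ξ) (Ioc 0 T) := by
  have : ∀ n : ℕ, ∀ᵐ ξ, ξ ∈ Metric.closedBall (0 : V) n →
      IntegrableOn (fun s => f s ξ) (Ioc 0 T) := fun n =>
    (ae_restrict_iff' measurableSet_closedBall).1 (hf.integrable_ball n).prod_left_ae
  filter_upwards [ae_all_iff.2 this] with ξ hξ
  obtain ⟨n, hn⟩ := exists_nat_ge ‖ξ‖
  exact hξ n (by simpa using hn)

/-- The equation `∂ₜ u = Δ h` with zero initial value, in Fourier variables. -/
theorem IsFluxTransform.fourier_eq {T : ℝ} {u h f : ℝ → V → ℂ} (hf : IsFluxTransform T h f)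
    (hu : ∀ᵐ t ∂(volume.restrict (Ioc 0 T)), Integrable (u t))
    (hweak : ∀ᵐ t ∂(volume.restrict (Ioc 0 T)), ∀ φ : 𝓢(V, ℂ),
      ∫ x, φ x * u t x = ∫ p, (Δ φ : 𝓢(V, ℂ)) p.2 * h p.1 p.2 ∂(stripMeasure V 0 t)) :
    ∀ᵐ t ∂(volume.restrict (Ioc 0 T)),
      ∀ᵐ ξ, 𝓕 (u t) ξ = -((2 * π) ^ 2 * ‖ξ‖ ^ 2 : ℝ) * timePrimitive f t ξ := by
  filter_upwards [hu, hweak, ae_restrict_mem measurableSet_Ioc] with t hut hwt ht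
  have hball : ∀ R : ℝ, Integrable (uncurry f)
      ((volume.restrict (Ioc 0 t)).prod (volume.restrict (Metric.closedBall (0 : V) R))) :=
    fun R => (hf.integrable_ball R).mono_measure
      (Measure.prod_mono (Measure.restrict_mono (Ioc_subset_Ioc_right ht.2) le_rfl) le_rfl)
  have hG : LocallyIntegrable (timePrimitive f t) := by
    refine (locallyIntegrable_iff).2 fun K hK => ?_
    obtain ⟨R, hR⟩ := hK.isBounded.subset_closedBall 0
    exact IntegrableOn.mono_set (hball R).integral_prod_right hR
  refine ae_eq_of_integral_schwartz (continuous_fourier hut).locallyIntegrable ?_ fun ψ hψ => ?_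
  · have : Continuous fun ξ : V => (-((2 * π) ^ 2 * ‖ξ‖ ^ 2 : ℝ) : ℂ) := by fun_prop
    exact hG.continuous_mul this
  · have h2 : (fun ξ : V => ‖ξ‖ ^ 2).HasTemperateGrowth := by fun_prop
    set ψ' := -(2 * π) ^ 2 • SchwartzMap.smulLeftCLM ℂ (fun ξ : V => ‖ξ‖ ^ 2) ψ with hψ'
    have hψ'x : ∀ ξ, ψ' ξ = -((2 * π) ^ 2 * ‖ξ‖ ^ 2 : ℝ) * ψ ξ := by
      intro ξ
      rw [hψ', smul_apply, SchwartzMap.smulLeftCLM_apply_apply h2, Complex.real_smul,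
        Complex.real_smul]
      push_cast; ring
    rw [integral_mul_fourier hut, hwt (𝓕 ψ), laplacian_fourier, ← hψ', ← hf.dual t ht]
    -- `f` is integrable on bounded sets only; this is where the compact support of `ψ` is used.
    have hint : Integrable (fun p : ℝ × V => ψ' p.2 * f p.1 p.2) (stripMeasure V 0 t) := by
      obtain ⟨R, hR⟩ := hψ.isCompact.isBounded.subset_closedBall 0
      have hsupp : support (fun p : ℝ × V => ψ' p.2 * f p.1 p.2) ⊆
          univ ×ˢ Metric.closedBall (0 : V) R := by
        refine support_subset_iff'.2 fun p hp => ?_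
        have : ψ p.2 = 0 := by
          by_contra hne
          exact hp ⟨mem_univ _, hR (subset_tsupport _ hne)⟩
        rw [hψ'x, this, mul_zero, zero_mul]
      rw [← integrableOn_iff_integrable_of_support_subset hsupp, IntegrableOn, stripMeasure,
        ← Measure.prod_restrict, Measure.restrict_univ]
      obtain ⟨C, hC⟩ := ψ'.toBoundedContinuousFunction.isBounded_range.exists_norm_le
      refine (hball R).bdd_mul (c := C) ?_ (Eventually.of_forall fun p => hC _ ⟨p.2, rfl⟩)
      exact (ψ'.continuous.comp continuous_snd).aestronglyMeasurable
    rw [integral_prod_symm _ hint]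
    refine integral_congr_ae (Eventually.of_forall fun ξ => ?_)
    simp only
    rw [integral_const_mul, hψ'x, timePrimitive]
    ring

end Energy

/-! ### Uniqueness for square integrable and for integrable fluxes -/

section Uniqueness

variable {V : Type*} [NormedAddCommGroup V] [InnerProductSpace ℝ V] [FiniteDimensional ℝ V]
  [MeasurableSpace V] [BorelSpace V]

theorem MemL2SectionL1.mono_measure {α : Type*} [MeasurableSpace α] {μ ν : Measure α}
    {g : α → V → ℂ} (hg : MemL2SectionL1 μ g) (h : ν ≤ μ) [SFinite μ] :
    MemL2SectionL1 ν g where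
  stronglyMeasurable := hg.stronglyMeasurable
  memLp := hg.memLp.mono_measure (Measure.prod_mono h le_rfl)
  section_integrable := ae_mono h hg.section_integrable

/-- Self-adjointness of the partial Fourier transform against a Schwartz function. -/
theorem integral_mul_fourier_section {α : Type*} [MeasurableSpace α] {μ : Measure α} [SFinite μ]
    {g : α → V → ℂ} (hg : ∀ᵐ s ∂μ, Integrable (g s)) (ψ : 𝓢(V, ℂ))
    (h₁ : Integrable (fun p => ψ p.2 * 𝓕 (g p.1) p.2) (μ.prod volume))
    (h₂ : Integrable (fun p => 𝓕 ψ p.2 * g p.1 p.2) (μ.prod volume)) :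
    ∫ p, ψ p.2 * 𝓕 (g p.1) p.2 ∂(μ.prod volume) =
      ∫ p, 𝓕 ψ p.2 * g p.1 p.2 ∂(μ.prod volume) := by
  rw [integral_prod _ h₁, integral_prod _ h₂]
  refine integral_congr_ae ?_
  filter_upwards [hg] with s hs using integral_mul_fourier hs ψ

/-- A density `u` and a flux `h` on `(0,T] × V`, with `u` solving `∂ₜ u = Δ h` from the zero initial
value in the sense of distributions, and with `u` and `h` of the same sign. -/
structure IsDissipativeSolution (T : ℝ) (u h : ℝ → V → ℂ) : Prop where
  stronglyMeasurable : StronglyMeasurable (uncurry u)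
  stronglyMeasurable_flux : StronglyMeasurable (uncurry h)
  integrable : ∀ᵐ t ∂(volume.restrict (Ioc 0 T)), Integrable (u t)
  weak_eq : ∀ᵐ t ∂(volume.restrict (Ioc 0 T)), ∀ φ : 𝓢(V, ℂ),
    ∫ x, φ x * u t x = ∫ p, (Δ φ : 𝓢(V, ℂ)) p.2 * h p.1 p.2 ∂(stripMeasure V 0 t)
  nonneg : ∀ᵐ p ∂(stripMeasure V 0 T), 0 ≤ (conj (u p.1 p.2) * h p.1 p.2).re

variable {T : ℝ} {u h f : ℝ → V → ℂ}

/-- The energy inequality between the times `t₀` and `t`, given Plancherel's formula `heq` for the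
pairing of density and flux on `(t₀,t] × V`. -/
theorem IsDissipativeSolution.energy_le (hs : IsDissipativeSolution T u h)
    (hf : IsFluxTransform T h f) {t₀ t : ℝ} (h0 : 0 ≤ t₀) (ht : t₀ ≤ t) (htT : t ≤ T)
    (hint : Integrable (fun p => conj (𝓕 (u p.1) p.2) * f p.1 p.2) (stripMeasure V t₀ t))
    (heq : ∫ p, conj (𝓕 (u p.1) p.2) * f p.1 p.2 ∂(stripMeasure V t₀ t) =
      ∫ p, conj (u p.1 p.2) * h p.1 p.2 ∂(stripMeasure V t₀ t))
    (hint' : Integrable (fun p => conj (u p.1 p.2) * h p.1 p.2) (stripMeasure V t₀ t))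
    (hA : Integrable fun ξ => ‖ξ‖ ^ 2 * ‖timePrimitive f t₀ ξ‖ ^ 2) :
    Integrable (fun ξ => ‖ξ‖ ^ 2 * ‖timePrimitive f t ξ‖ ^ 2) ∧
      ∫ ξ, ‖ξ‖ ^ 2 * ‖timePrimitive f t ξ‖ ^ 2 ≤ ∫ ξ, ‖ξ‖ ^ 2 * ‖timePrimitive f t₀ ξ‖ ^ 2 := by
  refine energy_inequality (c := (2 * π) ^ 2) (W := fun s ξ => 𝓕 (u s) ξ) (by positivity) h0 ht htT
    hf.ae_integrableOn ?_ hint ?_ hA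
  · refine (Measure.ae_ae_comm ?_).1 (hf.fourier_eq hs.integrable hs.weak_eq)
    refine measurableSet_eq_fun (stronglyMeasurable_fourier hs.stronglyMeasurable).measurable ?_
    refine Measurable.mul ?_ (stronglyMeasurable_timePrimitive hf.stronglyMeasurable).measurable
    fun_prop
  · rw [heq, ← RCLike.re_to_complex, ← integral_re hint']
    exact integral_nonneg_of_ae (ae_mono (stripMeasure_mono (Ioc_subset_Ioc h0 htT)) hs.nonneg)

/-- If the energy vanishes at almost every time, so does the density. -/
theorem IsDissipativeSolution.ae_eq_zero (hs : IsDissipativeSolution T u h)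
    (hf : IsFluxTransform T h f)
    (hA : ∀ᵐ t ∂(volume.restrict (Ioc 0 T)),
      Integrable (fun ξ => ‖ξ‖ ^ 2 * ‖timePrimitive f t ξ‖ ^ 2) ∧
      ∫ ξ, ‖ξ‖ ^ 2 * ‖timePrimitive f t ξ‖ ^ 2 ≤ 0) :
    ∀ᵐ t ∂(volume.restrict (Ioc 0 T)), u t =ᵐ[volume] 0 := by
  filter_upwards [hA, hf.fourier_eq hs.integrable hs.weak_eq, hs.integrable] with t hAt hft hut
  have hnn : ∀ ξ, 0 ≤ ‖ξ‖ ^ 2 * ‖timePrimitive f t ξ‖ ^ 2 := fun ξ => by positivity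
  have h0 := (integral_eq_zero_iff_of_nonneg hnn hAt.1).1
    (le_antisymm hAt.2 (integral_nonneg hnn))
  refine ae_eq_zero_of_fourier_ae_eq_zero hut ?_
  filter_upwards [h0, hft] with ξ h1 h2
  rw [h2]
  rcases mul_eq_zero.1 h1 with h3 | h3
  · rw [h3]; simp
  · rw [norm_eq_zero.1 (pow_eq_zero_iff two_ne_zero |>.1 h3)]; simp

/-- Uniqueness when the density and the flux are square integrable on `(0,T] × V`. -/
theorem IsDissipativeSolution.ae_eq_zero_of_memLp_two (hs : IsDissipativeSolution T u h)
    (hu : MemLp (uncurry u) 2 (stripMeasure V 0 T))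
    (hh : MemLp (uncurry h) 2 (stripMeasure V 0 T)) :
    ∀ᵐ t ∂(volume.restrict (Ioc 0 T)), u t =ᵐ[volume] 0 := by
  have hU : MemL2SectionL1 (volume.restrict (Ioc 0 T)) u :=
    ⟨hs.stronglyMeasurable, hu, hs.integrable⟩
  obtain ⟨f, hfm, hf2, hfd⟩ := exists_partialFourier hh
  have hsub : ∀ {t}, t ≤ T → Ioc 0 t ⊆ Ioc 0 T := fun h => Ioc_subset_Ioc_right h
  have hmono : ∀ {t}, t ≤ T → volume.restrict (Ioc 0 t) ≤ volume.restrict (Ioc 0 T) :=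
    fun h => Measure.restrict_mono (hsub h) le_rfl
  have hf : IsFluxTransform T h f := by
    refine ⟨hfm, fun t ht ψ => ?_, fun R => ?_⟩
    · have hψ : ∀ ψ : 𝓢(V, ℂ), MemLp (fun p : ℝ × V => ψ p.2) 2 (stripMeasure V 0 T) := fun ψ =>
        (ψ.memLp 2 volume).comp_snd _
      have := hfd (Ioc 0 t ×ˢ univ) (fun p => ψ p.2) (fun p => 𝓕 ψ p.2) (hψ ψ) (hψ (𝓕 ψ)) ?_
      · rwa [stripMeasure_eq_restrict (hsub ht.2)] at this
      · intro g hg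
        have hg' := hg.mono_measure (hmono ht.2)
        rw [stripMeasure_eq_restrict (hsub ht.2)]
        exact integral_mul_fourier_section hg'.section_integrable ψ
          (((ψ.memLp 2 volume).comp_snd _).integrable_mul hg'.memLp_fourier)
          ((((𝓕 ψ).memLp 2 volume).comp_snd _).integrable_mul hg'.memLp)
    · have : IsFiniteMeasure ((volume : Measure V).restrict (Metric.closedBall 0 R)) :=
        ⟨by simpa using measure_closedBall_lt_top⟩
      exact (hf2.mono_measure (Measure.prod_mono le_rfl Measure.restrict_le_self)).integrable
        one_le_two
  refine hs.ae_eq_zero hf ?_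
  filter_upwards [ae_restrict_mem measurableSet_Ioc] with t ht
  have hG0 : ∀ ξ, timePrimitive f 0 ξ = 0 := fun ξ => by simp [timePrimitive]
  have hle := stripMeasure_mono (V := V) (hsub ht.2)
  have hU' := hU.mono_measure (hmono ht.2)
  have := hs.energy_le hf le_rfl ht.1.le ht.2
    (hU'.memLp_fourier.star.integrable_mul (hf2.mono_measure hle)) ?_
    (hU'.memLp.star.integrable_mul (hh.mono_measure hle)) (by simp [hG0])
  · refine ⟨this.1, this.2.trans_eq (by simp [hG0])⟩
  · have := hfd (Ioc 0 t ×ˢ univ) (fun p => conj (𝓕 (u p.1) p.2)) (fun p => conj (u p.1 p.2))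
      hU.memLp_fourier.star hU.memLp.star ?_
    · rwa [stripMeasure_eq_restrict (hsub ht.2)] at this
    · intro g hg
      rw [stripMeasure_eq_restrict (hsub ht.2)]
      exact hU'.integral_conj_fourier_mul_fourier (hg.mono_measure (hmono ht.2))

/-- Uniqueness in dimension one, when the flux is integrable on `(0,T] × V` and square integrability
holds away from time `0`. -/
theorem IsDissipativeSolution.ae_eq_zero_of_finrank_eq_one (hs : IsDissipativeSolution T u h)
    (hd : Module.finrank ℝ V = 1)
    (hu : ∀ t₀ > 0, MemLp (uncurry u) 2 (stripMeasure V t₀ T))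
    (hh₁ : Integrable (uncurry h) (stripMeasure V 0 T))
    (hh : ∀ t₀ > 0, MemLp (uncurry h) 2 (stripMeasure V t₀ T))
    {C : ℝ} (hC : ∀ᵐ t ∂(volume.restrict (Ioc 0 T)), ∀ ξ, ‖𝓕 (u t) ξ‖ ≤ C) :
    ∀ᵐ t ∂(volume.restrict (Ioc 0 T)), u t =ᵐ[volume] 0 := by
  set f : ℝ → V → ℂ := fun s ξ => 𝓕 (h s) ξ with hf_def
  have hfm : StronglyMeasurable (uncurry f) := stronglyMeasurable_fourier hs.stronglyMeasurable_flux
  have hfk : ∀ s ξ, ‖f s ξ‖ ≤ ∫ x, ‖h s x‖ := fun s ξ => norm_fourier_le _ _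
  have hk : IntegrableOn (fun s => ∫ x, ‖h s x‖) (Ioc 0 T) := hh₁.norm.integral_prod_left
  have hhs : ∀ᵐ s ∂(volume.restrict (Ioc 0 T)), Integrable (h s) := hh₁.prod_right_ae
  have hf : IsFluxTransform T h f := by
    refine ⟨hfm, fun t ht ψ => ?_, fun R => ?_⟩
    · have hsub : Ioc 0 t ⊆ Ioc 0 T := Ioc_subset_Ioc_right ht.2
      refine integral_mul_fourier_section (ae_restrict_of_ae_restrict_of_subset hsub hhs) ψ ?_ ?_
      · refine ((hk.mono_set hsub).mul_prod ψ.integrable.norm).mono' ?_ ?_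
        · exact ((ψ.continuous.comp continuous_snd).stronglyMeasurable.mul hfm).aestronglyMeasurable
        · refine Eventually.of_forall fun p => ?_
          rw [norm_mul, mul_comm]
          exact mul_le_mul_of_nonneg_right (hfk _ _) (norm_nonneg _)
      · obtain ⟨D, hD⟩ := (𝓕 ψ).toBoundedContinuousFunction.isBounded_range.exists_norm_le
        refine (hh₁.mono_measure (stripMeasure_mono hsub)).bdd_mul (c := D) ?_
          (Eventually.of_forall fun p => hD _ ⟨p.2, rfl⟩)
        exact ((𝓕 ψ).continuous.comp continuous_snd).aestronglyMeasurable
    · have : IsFiniteMeasure ((volume : Measure V).restrict (Metric.closedBall 0 R)) :=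
        ⟨by simpa using measure_closedBall_lt_top⟩
      exact (Integrable.comp_fst hk _).mono' hfm.aestronglyMeasurable
        (Eventually.of_forall fun p => hfk _ _)
  set D := ∫ s in Ioc 0 T, ∫ x, ‖h s x‖
  have hGD : ∀ t ≤ T, ∀ ξ, ‖timePrimitive f t ξ‖ ≤ D := by
    intro t ht ξ
    calc ‖timePrimitive f t ξ‖ ≤ ∫ s in Ioc 0 t, ∫ x, ‖h s x‖ :=
          norm_integral_le_of_norm_le (hk.mono_set (Ioc_subset_Ioc_right ht))
            (Eventually.of_forall fun s => hfk s ξ)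
      _ ≤ D := setIntegral_mono_set hk
          (Eventually.of_forall fun s => integral_nonneg fun x => norm_nonneg _)
          (Ioc_subset_Ioc_right ht).eventuallyLE
  set M := D ^ 2 + 2 * (C / (2 * π) ^ 2) ^ 2
  -- At almost every time the energy density is dominated by a fixed integrable function: near
  -- `ξ = 0` because the flux is integrable, at infinity because the density is bounded in `L¹`.
  have hbound : ∀ᵐ t ∂(volume.restrict (Ioc 0 T)), ∀ᵐ ξ,
      ‖ξ‖ ^ 2 * ‖timePrimitive f t ξ‖ ^ 2 ≤ M * (1 + ‖ξ‖ ^ 2) ^ (-(2 : ℝ) / 2) := by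
    filter_upwards [hC, hf.fourier_eq hs.integrable hs.weak_eq, ae_restrict_mem measurableSet_Ioc]
      with t hCt hft ht
    filter_upwards [hft] with ξ hξ
    have h1 := hCt ξ
    rw [hξ, norm_mul, norm_neg, Complex.norm_real, Real.norm_of_nonneg (by positivity)] at h1
    have h2 : ‖ξ‖ ^ 2 * ‖timePrimitive f t ξ‖ ≤ C / (2 * π) ^ 2 := by
      rw [le_div_iff₀ (by positivity)]; linarith
    have h3 : ‖timePrimitive f t ξ‖ ^ 2 ≤ D ^ 2 :=
      pow_le_pow_left₀ (norm_nonneg _) (hGD t ht.2 ξ) 2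
    have h4 := pow_le_pow_left₀ (by positivity) h2 2
    rw [show (-(2 : ℝ) / 2) = -1 by norm_num, Real.rpow_neg_one, ← div_eq_mul_inv,
      le_div_iff₀ (by positivity)]
    -- With `g = |G|²` and `x = |ξ|²` the claim is `(1 + x) x g ≤ D² + 2 (C / (2π)²)²`; it follows
    -- from `g ≤ D²`, `x² g ≤ (C / (2π)²)²` and `x ≤ (1 + x²) / 2`.
    have h5 : 0 ≤ ‖timePrimitive f t ξ‖ ^ 2 * (‖ξ‖ ^ 2 - 1) ^ 2 := by positivity
    nlinarith
  have hMint : Integrable (fun ξ : V => M * (1 + ‖ξ‖ ^ 2) ^ (-(2 : ℝ) / 2)) :=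
    (integrable_rpow_neg_one_add_norm_sq (by rw [hd]; norm_num)).const_mul M
  have hAm : ∀ t, AEStronglyMeasurable
      (fun ξ => ‖ξ‖ ^ 2 * ‖timePrimitive f t ξ‖ ^ 2) (volume : Measure V) := fun t => by
    have := ((stronglyMeasurable_timePrimitive hfm).comp_measurable
      (measurable_prodMk_left (x := t))).norm.pow 2
    exact ((continuous_norm.pow 2).stronglyMeasurable.mul this).aestronglyMeasurable
  refine hs.ae_eq_zero hf ?_
  filter_upwards [ae_restrict_mem measurableSet_Ioc] with t ht
  -- The bound holds at almost every time only, so `t₀ → 0` along a sequence of good times.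
  have hex : ∀ n : ℕ, ∃ s ∈ Ioc 0 (min t (1 / ((n : ℝ) + 1))), ∀ᵐ ξ : V,
      ‖ξ‖ ^ 2 * ‖timePrimitive f s ξ‖ ^ 2 ≤ M * (1 + ‖ξ‖ ^ 2) ^ (-(2 : ℝ) / 2) := by
    intro n
    have hpos : 0 < min t (1 / ((n : ℝ) + 1)) := lt_min ht.1 (by positivity)
    have : (ae ((volume : Measure ℝ).restrict (Ioc 0 (min t (1 / ((n : ℝ) + 1)))))).NeBot := by
      rw [ae_restrict_neBot, Real.volume_Ioc]; simpa using hpos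
    have hsub : Ioc 0 (min t (1 / ((n : ℝ) + 1))) ⊆ Ioc 0 T :=
      Ioc_subset_Ioc_right ((min_le_left _ _).trans ht.2)
    obtain ⟨s, hs1, hs2⟩ := ((ae_restrict_of_ae_restrict_of_subset hsub hbound).and
      (ae_restrict_mem measurableSet_Ioc)).exists
    exact ⟨s, hs2, hs1⟩
  choose τ hτ hτb using hex
  have hτ0 : Tendsto τ atTop (𝓝 0) :=
    tendsto_of_tendsto_of_tendsto_of_le_of_le tendsto_const_nhds
      tendsto_one_div_add_atTop_nhds_zero_nat (fun n => (hτ n).1.le)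
      (fun n => (hτ n).2.trans (min_le_right _ _))
  have hτt : ∀ n, τ n ≤ t := fun n => (hτ n).2.trans (min_le_left _ _)
  have henergy : ∀ n, Integrable (fun ξ => ‖ξ‖ ^ 2 * ‖timePrimitive f t ξ‖ ^ 2) ∧
      ∫ ξ, ‖ξ‖ ^ 2 * ‖timePrimitive f t ξ‖ ^ 2 ≤
        ∫ ξ, ‖ξ‖ ^ 2 * ‖timePrimitive f (τ n) ξ‖ ^ 2 := by
    intro n
    have hsub : Ioc (τ n) t ⊆ Ioc 0 T := Ioc_subset_Ioc (hτ n).1.le ht.2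
    have hle := stripMeasure_mono (V := V) (Ioc_subset_Ioc le_rfl ht.2 : Ioc (τ n) t ⊆ Ioc (τ n) T)
    have hU : MemL2SectionL1 (volume.restrict (Ioc (τ n) t)) u := ⟨hs.stronglyMeasurable,
      (hu _ (hτ n).1).mono_measure hle, ae_restrict_of_ae_restrict_of_subset hsub hs.integrable⟩
    have hH : MemL2SectionL1 (volume.restrict (Ioc (τ n) t)) h := ⟨hs.stronglyMeasurable_flux,
      (hh _ (hτ n).1).mono_measure hle, ae_restrict_of_ae_restrict_of_subset hsub hhs⟩
    exact hs.energy_le hf (hτ n).1.le (hτt n) ht.2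
      (hU.memLp_fourier.star.integrable_mul hH.memLp_fourier)
      (hU.integral_conj_fourier_mul_fourier hH) (hU.memLp.star.integrable_mul hH.memLp)
      (hMint.mono' (hAm _) ((hτb n).mono fun ξ hξ => by
        rwa [Real.norm_of_nonneg (by positivity)]))
  refine ⟨(henergy 0).1, ?_⟩
  have hlim : Tendsto (fun n => ∫ ξ : V, ‖ξ‖ ^ 2 * ‖timePrimitive f (τ n) ξ‖ ^ 2) atTop
      (𝓝 (∫ _ : V, (0 : ℝ))) := by
    refine tendsto_integral_of_dominated_convergence _ (fun n => hAm _) hMint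
      (fun n => (hτb n).mono fun ξ hξ => by rwa [Real.norm_of_nonneg (by positivity)]) ?_
    filter_upwards [hf.ae_integrableOn] with ξ hξ
    have hcont := (intervalIntegral.continuousOn_primitive (a := 0) (b := T)
      ((integrableOn_Icc_iff_integrableOn_Ioc).2 hξ)) 0 ⟨le_rfl, ht.1.le.trans ht.2⟩
    have h0 : Tendsto (fun n => timePrimitive f (τ n) ξ) atTop (𝓝 0) := by
      have := hcont.tendsto.comp (tendsto_nhdsWithin_iff.2 ⟨hτ0, Eventually.of_forall fun n =>
        ⟨(hτ n).1.le, (hτt n).trans ht.2⟩⟩)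
      simpa [timePrimitive, Function.comp_def] using this
    simpa using (h0.norm.pow 2).const_mul (‖ξ‖ ^ 2)
  rw [integral_zero] at hlim
  exact ge_of_tendsto' hlim fun n => (henergy n).2

end Uniqueness

/-! ### Reduction to the densities -/

section Reduction

theorem laplacian_postcompCLM {V : Type*} [NormedAddCommGroup V] [InnerProductSpace ℝ V]
    [FiniteDimensional ℝ V] (L : ℂ →L[ℝ] ℝ) (φ : 𝓢(V, ℂ)) (x : V) :
    Δ (φ.postcompCLM L : V → ℝ) x = L ((Δ φ : 𝓢(V, ℂ)) x) := by
  rw [SchwartzMap.laplacian_apply]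
  exact ((φ.smooth 2).contDiffAt).laplacian_CLM_comp_left (l := L)

variable {d : ℕ} {T : ℝ} {a : ℝ → E d → ℝ} {z₀ : SignedMeasure (E d)}
  {z z₁ z₂ : ℝ → SignedMeasure (E d)} {u : ℝ → E d → ℝ}

theorem stripMeasure_eq_volume_restrict (s t : ℝ) :
    stripMeasure (E d) s t = volume.restrict (Icc s t ×ˢ univ) := by
  rw [stripMeasure, Measure.volume_eq_prod, ← Measure.prod_restrict, Measure.restrict_univ,
    Measure.restrict_congr_set Ioc_ae_eq_Icc]

/-- The weak formulation satisfied by the difference of two solutions, in terms of its density. -/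
theorem weak_eq_sub (h₁ : IsDistributionalSolution T a z₀ z₁)
    (h₂ : IsDistributionalSolution T a z₀ z₂)
    (hu : HasSpaceTimeDensity T (fun t => z₁ t - z₂ t) u) (φ : 𝓢(E d, ℝ)) {t : ℝ}
    (ht : t ∈ Icc 0 T) :
    ∫ᵛ x, φ x ∂<•(z₁ t - z₂ t) =
      ∫ s in Ioc 0 t, ∫ x, (Δ (φ : E d → ℝ)) x * (a s x * u s x) := by
  have hφ : ∀ μ : SignedMeasure (E d), μ.Integrable φ := fun μ =>
    φ.toBoundedContinuousFunction.integrable_variation μ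
  have hi : ∀ {z : ℝ → SignedMeasure (E d)}, IsDistributionalSolution T a z₀ z →
      IntervalIntegrable (fun s => ∫ᵛ x, (Δ (φ : E d → ℝ)) x * a s x ∂<•(z s)) volume 0 t :=
    fun hz => (intervalIntegrable_iff_integrableOn_Icc_of_le ht.1).2
      ((hz.integrable_time φ).mono_set (Icc_subset_Icc_right ht.2))
  rw [VectorMeasure.integral_sub_vectorMeasure (hφ _) (hφ _), h₁.weak_eq φ t ht, h₂.weak_eq φ t ht,
    add_sub_add_left_eq_sub, ← intervalIntegral.integral_sub (hi h₁) (hi h₂),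
    intervalIntegral.integral_of_le ht.1]
  have hsub : Ioc 0 t ⊆ Icc 0 T := Ioc_subset_Icc_self.trans (Icc_subset_Icc_right ht.2)
  refine integral_congr_ae ?_
  filter_upwards [ae_restrict_of_ae_restrict_of_subset hsub (h₁.integrable_space φ),
    ae_restrict_of_ae_restrict_of_subset hsub (h₂.integrable_space φ),
    ae_restrict_of_ae_restrict_of_subset hsub hu.density] with s i1 i2 hs
  rw [← VectorMeasure.integral_sub_vectorMeasure i1 i2]
  have := integrable_variation_sub i1 i2
  rw [hs.2] at this ⊢
  rw [integral_withDensityᵥ hs.1 this]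
  simp only [mul_assoc]

/-- A uniform bound on the Fourier transforms of the densities of a weakly continuous family. -/
theorem exists_norm_fourier_le (hz : IsWeaklyContinuous T z) (hu : HasSpaceTimeDensity T z u) :
    ∃ C, ∀ᵐ t ∂(volume.restrict (Icc 0 T)), ∀ ξ, ‖𝓕 (fun x => (u t x : ℂ)) ξ‖ ≤ C := by
  obtain ⟨C, hC⟩ := hz.exists_bound
  -- One `C` for the real part and one for the imaginary part of the character.
  refine ⟨C + C, ?_⟩
  filter_upwards [hu.density, ae_restrict_mem measurableSet_Icc] with t hut ht ξ
  have hC0 : 0 ≤ C := by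
    have := (norm_nonneg _).trans (hC t ht 1)
    rcases isEmpty_or_nonempty (E d) with h | h
    · exact (h.elim 0)
    · simpa using this
  have hchar : Continuous fun x : E d => ((Real.fourierChar (-(inner ℝ x ξ)) : Circle) : ℂ) :=
    continuous_subtype_val.comp (Real.continuous_fourierChar.comp (by fun_prop))
  have hint : Integrable fun x : E d =>
      ((Real.fourierChar (-(inner ℝ x ξ)) : Circle) : ℂ) * (u t x : ℂ) :=
    (hut.1.ofReal (𝕜 := ℂ)).bdd_mul (c := 1) hchar.aestronglyMeasurable
      (Eventually.of_forall fun x => (Circle.norm_coe _).le)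
  have key : ∀ L : ℂ →L[ℝ] ℝ, (∀ w, ‖L w‖ ≤ ‖w‖) →
      ‖∫ x, L ((Real.fourierChar (-(inner ℝ x ξ)) : Circle) : ℂ) * u t x‖ ≤ C := by
    intro L hL
    let k : E d →ᵇ ℝ := BoundedContinuousFunction.ofNormedAddCommGroup
      (fun x => L ((Real.fourierChar (-(inner ℝ x ξ)) : Circle) : ℂ)) (L.continuous.comp hchar) 1
      (fun x => (hL _).trans (Circle.norm_coe _).le)
    have hk := hC t ht k
    have hki := k.integrable_variation (z t)
    rw [hut.2] at hk hki
    rw [integral_withDensityᵥ hut.1 hki] at hk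
    refine hk.trans (mul_le_of_le_one_right hC0 ?_)
    exact BoundedContinuousFunction.norm_ofNormedAddCommGroup_le _ zero_le_one _
  have hre := key Complex.reCLM fun w => by simpa using Complex.abs_re_le_norm w
  have him := key Complex.imCLM fun w => by simpa using Complex.abs_im_le_norm w
  simp only [Real.fourier_eq, Circle.smul_def, smul_eq_mul]
  refine (Complex.norm_le_abs_re_add_abs_im _).trans (add_le_add ?_ ?_)
  · rw [← RCLike.re_to_complex, ← integral_re hint]
    simpa using hre
  · rw [← RCLike.im_to_complex, ← integral_im hint]
    simpa using him

/-- Complex-valued strongly measurable versions of the density and of the flux form a dissipative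
solution. -/
theorem isDissipativeSolution (ha_nonneg : ∀ t ∈ Icc 0 T, ∀ x, 0 ≤ a t x)
    (h₁ : IsDistributionalSolution T a z₀ z₁) (h₂ : IsDistributionalSolution T a z₀ z₂)
    (hu : HasSpaceTimeDensity T (fun t => z₁ t - z₂ t) u) {v k : ℝ × E d → ℝ}
    (hv : StronglyMeasurable v) (hk : StronglyMeasurable k)
    (huv : uncurry u =ᵐ[stripMeasure (E d) 0 T] v)
    (hauk : (uncurry fun t x => a t x * u t x) =ᵐ[stripMeasure (E d) 0 T] k)
    (hint : ∀ g : 𝓢(E d, ℂ), Integrable (fun p => g p.2 * (k p : ℂ)) (stripMeasure (E d) 0 T)) :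
    IsDissipativeSolution T (fun t x => (v (t, x) : ℂ)) (fun t x => (k (t, x) : ℂ)) := by
  have hdens : ∀ᵐ t ∂(volume.restrict (Ioc 0 T)),
      Integrable (u t) ∧ z₁ t - z₂ t = volume.withDensityᵥ (u t) :=
    ae_restrict_of_ae_restrict_of_subset Ioc_subset_Icc_self hu.density
  have huv' := Measure.ae_ae_of_ae_prod huv
  have hauk' := Measure.ae_ae_of_ae_prod hauk
  have hvi : ∀ᵐ t ∂(volume.restrict (Ioc 0 T)), Integrable fun x => v (t, x) := by
    filter_upwards [hdens, huv'] with t h1 h2 using h1.1.congr h2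
  refine ⟨?_, ?_, hvi.mono fun t h => h.ofReal, ?_, ?_⟩
  · exact Complex.continuous_ofReal.comp_stronglyMeasurable hv
  · exact Complex.continuous_ofReal.comp_stronglyMeasurable hk
  · filter_upwards [hdens, huv', hvi, ae_restrict_mem measurableSet_Ioc] with t h1 h2 hvt ht φ
    have hsub : Ioc 0 t ⊆ Ioc 0 T := Ioc_subset_Ioc_right ht.2
    have i1 : Integrable fun x => φ x * (v (t, x) : ℂ) := by
      obtain ⟨C, hC⟩ := φ.toBoundedContinuousFunction.isBounded_range.exists_norm_le
      exact (hvt.ofReal (𝕜 := ℂ)).bdd_mul (c := C) φ.continuous.aestronglyMeasurable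
        (Eventually.of_forall fun p => hC _ ⟨p, rfl⟩)
    have i2 := (hint (Δ φ)).mono_measure (stripMeasure_mono hsub)
    -- The weak formulation is given for real test functions; it is applied to the real and the
    -- imaginary parts of `φ`.
    have key : ∀ L : ℂ →L[ℝ] ℝ, ∫ x, L (φ x) * v (t, x) =
        ∫ p, L ((Δ φ : 𝓢(E d, ℂ)) p.2) * k p ∂(stripMeasure (E d) 0 t) := by
      intro L
      have e1 := weak_eq_sub h₁ h₂ hu (φ.postcompCLM L) ⟨ht.1.le, ht.2⟩
      have e2 := (φ.postcompCLM L).toBoundedContinuousFunction.integrable_variation (z₁ t - z₂ t)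
      rw [h1.2] at e1 e2
      have e3 := integral_withDensityᵥ h1.1 e2
      have i3 : Integrable (fun p => L ((Δ φ : 𝓢(E d, ℂ)) p.2) * k p)
          (stripMeasure (E d) 0 t) := by
        refine (L.integrable_comp i2).congr (Eventually.of_forall fun p => ?_)
        simp only
        rw [mul_comm, ← Complex.real_smul, map_smul, smul_eq_mul, mul_comm]
      calc ∫ x, L (φ x) * v (t, x) = ∫ x, (φ.postcompCLM L) x * u t x := by
            refine integral_congr_ae ?_
            filter_upwards [h2] with x hx
            rw [← hx]; rfl
        _ = _ := e3.symm
        _ = _ := e1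
        _ = _ := by
            rw [integral_prod _ i3]
            refine integral_congr_ae ?_
            filter_upwards [ae_restrict_of_ae_restrict_of_subset hsub hauk'] with s hs
            refine integral_congr_ae ?_
            filter_upwards [hs] with x hx
            rw [laplacian_postcompCLM, ← hx]; rfl
    apply Complex.ext
    · have := key Complex.reCLM
      rw [← RCLike.re_to_complex, ← RCLike.re_to_complex, ← integral_re i1, ← integral_re i2]
      simpa using this
    · have := key Complex.imCLM
      rw [← RCLike.im_to_complex, ← RCLike.im_to_complex, ← integral_im i1, ← integral_im i2]
      simpa using this
  · have hmem : ∀ᵐ p ∂(stripMeasure (E d) 0 T), p.1 ∈ Icc 0 T := by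
      rw [stripMeasure_eq_volume_restrict]
      filter_upwards [ae_restrict_mem (measurableSet_Icc.prod MeasurableSet.univ)] with p hp
      exact hp.1
    filter_upwards [huv, hauk, hmem] with p h1 h2 hp
    rw [Prod.mk.eta, ← h1, ← h2, uncurry, uncurry, Complex.conj_ofReal, ← Complex.ofReal_mul,
      Complex.ofReal_re]
    nlinarith [mul_nonneg (ha_nonneg p.1 hp p.2) (mul_self_nonneg (u p.1 p.2))]

end Reduction

end FokkerPlanck

theorem theorem3p1 (d : ℕ) (hd : 0 < d) (T : ℝ) (hT : 0 < T)
    (a : ℝ → FokkerPlanck.E d → ℝ)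
    (ha_borel : FokkerPlanck.IsBorelOnStrip T a)
    (ha_nonneg : ∀ t ∈ Set.Icc 0 T, ∀ x, 0 ≤ a t x)
    (z₀ : MeasureTheory.SignedMeasure (FokkerPlanck.E d))
    (z₁ z₂ : ℝ → MeasureTheory.SignedMeasure (FokkerPlanck.E d))
    (hz₁_cont : FokkerPlanck.IsWeaklyContinuous T z₁)
    (hz₂_cont : FokkerPlanck.IsWeaklyContinuous T z₂)
    (hz₁ : FokkerPlanck.IsDistributionalSolution T a z₀ z₁)
    (hz₂ : FokkerPlanck.IsDistributionalSolution T a z₀ z₂)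
    (hB : FokkerPlanck.HypothesisB T a (fun t => z₁ t - z₂ t)) :
    ∀ t ∈ Set.Icc 0 T, z₁ t - z₂ t = 0 := by
  obtain ⟨u, hu, hcases⟩ := hB
  have hcont := hz₁_cont.sub hz₂_cont
  refine hcont.eq_zero_of_ae hT ?_
  have hS : MeasurableSet (Icc 0 T ×ˢ (univ : Set (FokkerPlanck.E d))) :=
    measurableSet_Icc.prod MeasurableSet.univ
  have hum : AEStronglyMeasurable (uncurry u)
      (FokkerPlanck.stripMeasure (FokkerPlanck.E d) 0 T) := by
    rw [FokkerPlanck.stripMeasure_eq_volume_restrict]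
    exact hu.locallyIntegrable.aestronglyMeasurable
  have ham : AEStronglyMeasurable (uncurry a)
      (FokkerPlanck.stripMeasure (FokkerPlanck.E d) 0 T) := by
    rw [FokkerPlanck.stripMeasure_eq_volume_restrict]
    exact (aemeasurable_restrict_of_measurable_subtype hS ha_borel).aestronglyMeasurable
  have haum : AEStronglyMeasurable (uncurry fun t x => a t x * u t x)
      (FokkerPlanck.stripMeasure (FokkerPlanck.E d) 0 T) := ham.mul hum
  have hv := hum.ae_eq_mk
  have hk := haum.ae_eq_mk
  have hvL : ∀ t₀ ≥ 0, ∀ p, MemLp (uncurry u) p (volume.restrict (Icc t₀ T ×ˢ univ)) →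
      MemLp (fun q => (hum.mk _ q : ℂ)) p (FokkerPlanck.stripMeasure (FokkerPlanck.E d) t₀ T) := by
    intro t₀ ht₀ p h
    rw [← FokkerPlanck.stripMeasure_eq_volume_restrict] at h
    exact (h.ae_eq (ae_mono (FokkerPlanck.stripMeasure_mono (Ioc_subset_Ioc_left ht₀)) hv)).ofReal
  have hkL : ∀ t₀ ≥ 0, ∀ p,
      MemLp (uncurry fun t x => a t x * u t x) p (volume.restrict (Icc t₀ T ×ˢ univ)) →
      MemLp (fun q => (haum.mk _ q : ℂ)) p (FokkerPlanck.stripMeasure (FokkerPlanck.E d) t₀ T) := by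
    intro t₀ ht₀ p h
    rw [← FokkerPlanck.stripMeasure_eq_volume_restrict] at h
    exact (h.ae_eq (ae_mono (FokkerPlanck.stripMeasure_mono (Ioc_subset_Ioc_left ht₀)) hk)).ofReal
  have hmain : ∀ᵐ t ∂(volume.restrict (Ioc 0 T)),
      (fun x => (hum.mk _ (t, x) : ℂ)) =ᵐ[volume] 0 := by
    rcases hcases with hB1 | hB2
    · have hkk := hkL 0 le_rfl 2 hB1.flux_sq
      have hs := FokkerPlanck.isDissipativeSolution ha_nonneg hz₁ hz₂ hu
        hum.stronglyMeasurable_mk haum.stronglyMeasurable_mk hv hk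
        fun g => ((g.memLp 2 volume).comp_snd _).integrable_mul hkk
      exact hs.ae_eq_zero_of_memLp_two (hvL 0 le_rfl 2 hB1.density_sq) hkk
    · have hkk := memLp_one_iff_integrable.1 (hkL 0 le_rfl 1 hB2.flux)
      have hs := FokkerPlanck.isDissipativeSolution ha_nonneg hz₁ hz₂ hu
        hum.stronglyMeasurable_mk haum.stronglyMeasurable_mk hv hk fun g => by
          obtain ⟨C, hC⟩ := g.toBoundedContinuousFunction.isBounded_range.exists_norm_le
          exact hkk.bdd_mul (c := C) (g.continuous.comp continuous_snd).aestronglyMeasurable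
            (Filter.Eventually.of_forall fun p => hC _ ⟨p.2, rfl⟩)
      obtain ⟨C, hC⟩ := FokkerPlanck.exists_norm_fourier_le hcont hu
      refine hs.ae_eq_zero_of_finrank_eq_one (by simp [hB2.dim_one])
        (fun t₀ ht₀ => hvL t₀ ht₀.le 2 (hB2.density_sq t₀ ht₀)) hkk
        (fun t₀ ht₀ => hkL t₀ ht₀.le 2 (hB2.flux_sq t₀ ht₀)) (C := C) ?_
      filter_upwards [ae_restrict_of_ae_restrict_of_subset Ioc_subset_Icc_self hC,
        Measure.ae_ae_of_ae_prod hv] with t h1 h2 ξ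
      rw [← Real.fourier_congr_ae (h2.mono fun x hx => congrArg ((↑) : ℝ → ℂ) hx) ξ]
      exact h1 ξ
  rw [← Measure.restrict_congr_set Ioc_ae_eq_Icc]
  filter_upwards [hmain, Measure.ae_ae_of_ae_prod hv,
    ae_restrict_of_ae_restrict_of_subset Ioc_subset_Icc_self hu.density] with t h1 h2 h3
  have h0 : u t =ᵐ[volume] 0 := by
    filter_upwards [h1, h2] with x hx1 hx2
    rw [Pi.zero_apply, ← Complex.ofReal_eq_zero]
    exact (congrArg ((↑) : ℝ → ℂ) hx2).trans hx1
  rw [h3.2, WithDensityᵥEq.congr_ae h0, withDensityᵥ_zero]
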